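/- Let $R\in(0,1)$. For integers $m\ge 1$ and $r\ge 0$, let $\mathrm{RM}(m,r)\subseteq\mathbb{F}_2^{2^m}$ be the binary Reed--Muller code, i.e. the set of evaluation vectors $(f(\mathbf z))_{\mathbf z\in\mathbb{F}_2^m}$ of polynomials $f\in\mathbb{F}_2[x_1,\dots,x_m]$ of degree at most $r$, the coordinates $\mathbf z=(z_1,\dots,z_m)$ being arranged in the standard lexicographic order. Let $\mathcal{C}_m(R)=\mathrm{RM}(m,r_m)$ with $$r_m=\max\left\{\left\lfloor \frac m2+\frac{\sqrt m}{2}\,Q^{-1}(1-R)\right\rfloor,\,0\right\},\qquad Q(t)=\frac1{\sqrt{2\pi}}\int_t^\infty e^{-\tau^2/2}\,d\tau .$$ A $(1,\infty)$-RLL subcode of $\mathcal{C}_m(R)$ is a nonempty subset (linear or not) of $\mathcal{C}_m(R)$, none of whose words has two consecutive $1$s. Then $$\limsup_{m\to\infty}\ \max_{\mathcal{C}\subseteq\mathcal{C}_m(R)}\frac{\log_2|\mathcal{C}|}{2^m}\ \le\ \min\left(\frac{7R}{8},\,C_0^{(1)}\right),$$ where the maximum is over all $(1,\infty)$-RLL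 subcodes $\mathcal{C}$ of $\mathcal{C}_m(R)$, and $$C_0^{(1)}=\log_2\left(\frac{1+\sqrt5}{2}\right)$$ is the noiseless capacity of the $(1,\infty)$-RLL constraint, i.e. $C_0^{(1)}=\lim_{n\to\infty}\frac1n\log_2|S^{(n)}|$, with $S^{(n)}$ the set of binary words of length $n$ without two consecutive $1$s. -/

import Mathlib

open Filter Topology MeasureTheory

/-- The `(d, ∞)`-RLL constraint on a binary word of length `n` (with letters in `𝔽₂`): any two `1`s
are separated by at least `d` `0`s, i.e. positions `i < j` carrying `1`s satisfy `j - i > d`. -/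
def IsRLL (d : ℕ) {n : ℕ} (c : Fin n → ZMod 2) : Prop :=
  ∀ i j : Fin n, i < j → c i = 1 → c j = 1 → (i : ℕ) + d < (j : ℕ)

/-- The rate `log₂ |C| / n` of a binary block code `C` of blocklength `n`. -/
noncomputable def codeRate {n : ℕ} (C : Finset (Fin n → ZMod 2)) : ℝ :=
  Real.logb 2 (C.card : ℝ) / (n : ℝ)

/-- `c₀` is the noiseless capacity of the `(d, ∞)`-RLL constraint: the limit, as `n → ∞`, of
`log₂ |S| / n`, where `S` is the set of all `(d, ∞)`-RLL words of length `n`. -/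
def IsNoiselessCapacity (d : ℕ) (c₀ : ℝ) : Prop :=
  Tendsto (fun n : ℕ => Real.logb 2 (({c : Fin n → ZMod 2 | IsRLL d c}.ncard : ℕ) : ℝ) / (n : ℝ))
    atTop (𝓝 c₀)

/-- The `i`-th point of `𝔽₂ᵐ` in the standard lexicographic order (`0 ≤ i < 2ᵐ`): the length-`m`
binary representation of `i`, most significant bit first. -/
def lexPoint (m : ℕ) (i : Fin (2 ^ m)) : Fin m → ZMod 2 :=
  fun j => if (i : ℕ).testBit (m - 1 - (j : ℕ)) then 1 else 0

/-- The enumeration `lexPoint` is increasing for the lexicographic order. -/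
theorem lexPoint_lex (m : ℕ) {i i' : Fin (2 ^ m)} (h : i < i') :
    ∃ k : Fin m, (∀ j : Fin m, j < k → lexPoint m i j = lexPoint m i' j) ∧
      lexPoint m i k = 0 ∧ lexPoint m i' k = 1 := by
  by_contra hcon
  push Not at hcon
  have key : ∀ l : ℕ, (i' : ℕ).testBit l = true →
      (∀ l' : ℕ, l < l' → (i : ℕ).testBit l' = (i' : ℕ).testBit l') →
      (i : ℕ).testBit l = true := by
    intro l hl hgt
    by_contra hi
    have hlm : l < m := by
      by_contra hlm
      rw [Nat.testBit_lt_two_pow (lt_of_lt_of_le i'.2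
        (Nat.pow_le_pow_right (by norm_num) (not_lt.mp hlm)))] at hl
      exact absurd hl (by simp)
    have e : m - 1 - (m - 1 - l) = l := by omega
    refine hcon ⟨m - 1 - l, by omega⟩ ?_ ?_ ?_
    · intro j hj
      have hj' : (j : ℕ) < m - 1 - l := hj
      simp only [lexPoint]
      rw [hgt (m - 1 - j) (by omega)]
    · simp only [lexPoint, e, hi]
      simp
    · simp only [lexPoint, e, hl]
      simp
  have hle : (i' : ℕ) ≤ (i : ℕ) := by
    by_contra hlt
    push Not at hlt
    obtain ⟨l, h1, h2, h3⟩ : ∃ l, (i : ℕ).testBit l = false ∧ (i' : ℕ).testBit l = true ∧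
        ∀ l', l < l' → (i : ℕ).testBit l' = (i' : ℕ).testBit l' := by
      obtain ⟨l, hl, hl'⟩ := Nat.exists_most_significant_bit
        (n := (i : ℕ) ^^^ (i' : ℕ)) (by rw [Ne, Nat.xor_eq_zero_iff]; omega)
      have hgt : ∀ l', l < l' → (i : ℕ).testBit l' = (i' : ℕ).testBit l' := by
        intro l' hll
        have := hl' l' hll
        rw [Nat.testBit_xor] at this
        simpa using this
      rw [Nat.testBit_xor] at hl
      cases ha : (i : ℕ).testBit l <;> cases hb : (i' : ℕ).testBit l
      · simp [ha, hb] at hl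
      · exact ⟨l, ha, hb, hgt⟩
      · exact absurd (Nat.lt_of_testBit l hb ha (fun j hj => (hgt j hj).symm)) (by omega)
      · simp [ha, hb] at hl
    have := key l h2 h3
    simp [h1] at this
  exact absurd h (not_lt.mpr hle)

/-- The binary Reed–Muller code `RM(m, r)`: evaluation vectors, with coordinates in the standard
lexicographic order, of polynomials over `𝔽₂` in `m` variables of degree at most `r`. -/
def reedMuller (m r : ℕ) : Set (Fin (2 ^ m) → ZMod 2) :=
  {c | ∃ f : MvPolynomial (Fin m) (ZMod 2), f.totalDegree ≤ r ∧
    c = fun i => MvPolynomial.eval (lexPoint m i) f}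

/-- The complementary cumulative distribution function of the standard normal distribution. -/
noncomputable def gaussianQ (t : ℝ) : ℝ :=
  1 / Real.sqrt (2 * Real.pi) * ∫ τ in Set.Ioi t, Real.exp (-τ ^ 2 / 2)

/-- The inverse of `Q : ℝ → (0, 1)`; only its values on `(0, 1)` are meaningful. -/
noncomputable def gaussianQInv : ℝ → ℝ := Function.invFun gaussianQ

/-- `Q` is a bijection from `ℝ` onto `(0, 1)`, so `gaussianQInv` is its inverse there. -/
theorem gaussianQ_bijOn : Set.BijOn gaussianQ Set.univ (Set.Ioo 0 1) := by
  have hint : Integrable (fun τ : ℝ => Real.exp (-τ ^ 2 / 2)) := by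
    have := integrable_exp_neg_mul_sq (b := 1 / 2) (by norm_num)
    refine this.congr (Eventually.of_forall fun x => ?_)
    simp only
    congr 1
    ring
  have htot : ∫ τ : ℝ, Real.exp (-τ ^ 2 / 2) = Real.sqrt (2 * Real.pi) := by
    have := integral_gaussian (1 / 2)
    rw [show Real.pi / (1 / 2) = 2 * Real.pi by ring] at this
    rw [← this]
    congr 1
    ext x
    congr 1
    ring
  have hs : 0 < Real.sqrt (2 * Real.pi) := by positivity
  have hdiff : ∀ a b : ℝ, (∫ τ in Set.Ioi a, Real.exp (-τ ^ 2 / 2)) =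
      (∫ τ in a..b, Real.exp (-τ ^ 2 / 2)) + ∫ τ in Set.Ioi b, Real.exp (-τ ^ 2 / 2) := by
    intro a b
    exact (intervalIntegral.integral_interval_add_Ioi hint.integrableOn hint.integrableOn).symm
  have hanti : StrictAnti gaussianQ := by
    intro a b hab
    have hpos : 0 < ∫ τ in a..b, Real.exp (-τ ^ 2 / 2) :=
      intervalIntegral.intervalIntegral_pos_of_pos hint.intervalIntegrable
        (fun x => Real.exp_pos _) hab
    simp only [gaussianQ]
    rw [hdiff a b]
    have : 0 < 1 / Real.sqrt (2 * Real.pi) := by positivity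
    nlinarith
  have hrep : gaussianQ = fun t => 1 / Real.sqrt (2 * Real.pi) *
      ((∫ τ in Set.Ioi (0 : ℝ), Real.exp (-τ ^ 2 / 2)) -
        ∫ τ in (0 : ℝ)..t, Real.exp (-τ ^ 2 / 2)) := by
    ext t
    simp only [gaussianQ]
    rw [hdiff 0 t]
    ring
  have hcont : Continuous gaussianQ := by
    rw [hrep]
    exact continuous_const.mul (continuous_const.sub
      (intervalIntegral.continuous_primitive (fun _ _ => hint.intervalIntegrable) 0))
  have htop : Tendsto gaussianQ atTop (𝓝 0) := by
    rw [hrep]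
    have := (tendsto_const_nhds (x := ∫ τ in Set.Ioi (0 : ℝ), Real.exp (-τ ^ 2 / 2))).sub
      (intervalIntegral_tendsto_integral_Ioi 0 hint.integrableOn tendsto_id)
    simpa using this.const_mul (1 / Real.sqrt (2 * Real.pi))
  have hbot : Tendsto gaussianQ atBot (𝓝 1) := by
    have h1 := intervalIntegral_tendsto_integral_Iic 0 hint.integrableOn tendsto_id
    have h2 := ((tendsto_const_nhds
      (x := ∫ τ in Set.Ioi (0 : ℝ), Real.exp (-τ ^ 2 / 2))).add h1).const_mul
        (1 / Real.sqrt (2 * Real.pi))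
    have h3 : (∫ τ in Set.Ioi (0 : ℝ), Real.exp (-τ ^ 2 / 2)) +
        ∫ τ in Set.Iic (0 : ℝ), Real.exp (-τ ^ 2 / 2) = Real.sqrt (2 * Real.pi) := by
      rw [add_comm, intervalIntegral.integral_Iic_add_Ioi hint.integrableOn hint.integrableOn, htot]
    rw [h3, one_div_mul_cancel hs.ne'] at h2
    refine h2.congr fun t => ?_
    simp only [gaussianQ, id]
    rw [hdiff t 0]
    ring
  refine ⟨fun t _ => ⟨?_, ?_⟩, hanti.injective.injOn, fun y hy => ?_⟩
  · exact lt_of_le_of_lt (hanti.antitone.le_of_tendsto htop (t + 1)) (hanti (by linarith))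
  · exact lt_of_lt_of_le (hanti (by linarith : t - 1 < t)) (hanti.antitone.ge_of_tendsto hbot _)
  · obtain ⟨a, ha⟩ := (htop.eventually_lt_const hy.1).exists
    obtain ⟨b, hb⟩ := (hbot.eventually_const_lt hy.2).exists
    obtain ⟨x, hx⟩ := mem_range_of_exists_le_of_exists_ge hcont ⟨a, ha.le⟩ ⟨b, hb.le⟩
    exact ⟨x, trivial, hx⟩

/-- `r_m = max {⌊m/2 + (√m/2) Q⁻¹(1 - R)⌋, 0}`. -/
noncomputable def canonicalOrder (R : ℝ) (m : ℕ) : ℕ :=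
  (max ⌊(m : ℝ) / 2 + Real.sqrt m / 2 * gaussianQInv (1 - R)⌋ 0).toNat

/-- The largest rate of a (nonempty, not necessarily linear) `(d, ∞)`-RLL subcode of `C`. It is a
maximum of finitely many real numbers, taken in the extended reals. -/
noncomputable def largestRLLRate (d : ℕ) {n : ℕ} (C : Set (Fin n → ZMod 2)) : EReal :=
  ⨆ (D : Finset (Fin n → ZMod 2)) (_ : D.Nonempty ∧ (D : Set (Fin n → ZMod 2)) ⊆ C ∧
    ∀ c ∈ D, IsRLL d c), ((codeRate D : ℝ) : EReal)

/-!
Positions `2 q` and `2 q + 1` of a word of `RM(m, r)` carry the values of a polynomial of degree at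
most `r` at two points of `𝔽₂ᵐ` that differ only in the last coordinate. In a word without
consecutive ones such a pair of values is `00`, `01` or `10`.

By the Chevalley–Warning theorem, a polynomial of degree at most `r` sums to zero over every
subcube of dimension greater than `r`. Hence it is determined by its values at the points with at
most `r` ones among the first `m - 1` coordinates
(`eval_eq_zero_of_eval_eq_zero_of_card_le`), that is, by `k = ∑_{i ≤ r} (m - 1).choose i` of the
pairs. So an RLL subcode has at most `3 ^ k` words (`card_le_of_isRLL_of_subset_reedMuller`).

For `r = r_m` the central limit theorem gives `k / 2 ^ (m - 1) → R`; only the upper bound is needed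
(`eventually_sum_choose_canonicalOrder_lt`). The rate is therefore at most `R * log₂ 3 / 2` in the
limit, and `log₂ 3 / 2 < 7 / 8`.

The number of all RLL words of length `n` is the Fibonacci number `fib (n + 2)`
(`ncard_isRLL_one`), which yields the capacity `log₂ φ` and with it the other bound on the rate.
-/

/-! ### The central limit theorem for binomial coefficients -/

/-- The law of `(2 B - n) / √n`, where `B` is binomial with parameters `n` and `1 / 2`. -/
noncomputable def scaledBinomial (n : ℕ) : Measure ℝ :=
  ∑ k ∈ Finset.range (n + 1),
    ENNReal.ofReal ((n.choose k : ℝ) / 2 ^ n) • Measure.dirac ((2 * k - n : ℝ) / √n)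

theorem integral_scaledBinomial {E : Type*} [NormedAddCommGroup E] [NormedSpace ℝ E]
    [CompleteSpace E] (n : ℕ) (f : ℝ → E) :
    ∫ x, f x ∂scaledBinomial n =
      ∑ k ∈ Finset.range (n + 1), ((n.choose k : ℝ) / 2 ^ n) • f ((2 * k - n : ℝ) / √n) := by
  rw [scaledBinomial, integral_finsetSum_measure]
  · refine Finset.sum_congr rfl fun k _ => ?_
    rw [integral_smul_measure, integral_dirac, ENNReal.toReal_ofReal (by positivity)]
  · intro k _
    exact (integrable_dirac (by simp)).smul_measure ENNReal.ofReal_ne_top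

theorem scaledBinomial_apply (n : ℕ) {s : Set ℝ} (hs : MeasurableSet s) :
    scaledBinomial n s = ENNReal.ofReal (∑ k ∈ Finset.range (n + 1),
      (n.choose k : ℝ) / 2 ^ n * s.indicator 1 ((2 * k - n : ℝ) / √n)) := by
  rw [ENNReal.ofReal_sum_of_nonneg]
  · simp only [scaledBinomial, Measure.coe_finsetSum, Finset.sum_apply, Measure.smul_apply,
      Measure.dirac_apply' _ hs, smul_eq_mul]
    refine Finset.sum_congr rfl fun k _ => ?_
    rw [ENNReal.ofReal_mul (by positivity)]
    congr 1
    by_cases h : (2 * k - n : ℝ) / √n ∈ s <;> simp [h]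
  · intro k _
    exact mul_nonneg (by positivity) (Set.indicator_nonneg (by simp) _)

instance (n : ℕ) : IsProbabilityMeasure (scaledBinomial n) := by
  refine ⟨?_⟩
  rw [scaledBinomial_apply n MeasurableSet.univ]
  simp only [Set.indicator_univ, Pi.one_apply, mul_one]
  rw [← Finset.sum_div, ← Nat.cast_sum, Nat.sum_range_choose]
  simp

theorem charFun_scaledBinomial (n : ℕ) (t : ℝ) :
    charFun (scaledBinomial n) t = Complex.cos (((√n)⁻¹ * t : ℝ)) ^ n := by
  rw [charFun_apply_real, integral_scaledBinomial, Complex.cos, div_pow, add_pow, Finset.sum_div]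
  refine Finset.sum_congr rfl fun k hk => ?_
  have hk' : k ≤ n := Nat.lt_succ_iff.mp (Finset.mem_range.mp hk)
  rw [← Complex.exp_nat_mul, ← Complex.exp_nat_mul, ← Complex.exp_add, Complex.real_smul]
  push_cast [hk']
  rw [show (t : ℂ) * ((2 * k - n) / (√n : ℝ)) * Complex.I =
    k * ((((√n : ℝ) : ℂ))⁻¹ * t * Complex.I) + (n - k) * (-((((√n : ℝ) : ℂ))⁻¹ * t) * Complex.I)
    by rw [div_eq_mul_inv]; ring]
  ring

/-- **De Moivre–Laplace theorem**, in terms of weak convergence. The characteristic function of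
`scaledBinomial n` is the `n`-th power of that of a centred coin toss, `scaledBinomial 1`. -/
theorem tendsto_scaledBinomial :
    Tendsto (β := ProbabilityMeasure ℝ) (fun n => ⟨scaledBinomial n, inferInstance⟩) atTop
      (𝓝 ⟨ProbabilityTheory.gaussianReal 0 1, inferInstance⟩) := by
  refine ProbabilityMeasure.tendsto_iff_tendsto_charFun.2 fun t => ?_
  have h := ProbabilityTheory.tendsto_charFun_inv_sqrt_mul_pow (P := scaledBinomial 1) (X := id)
    aemeasurable_id (by simp [integral_scaledBinomial, Finset.sum_range_succ]; norm_num)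
    (by simp [integral_scaledBinomial, Finset.sum_range_succ]; norm_num) t
  simpa [charFun_scaledBinomial, ProbabilityTheory.charFun_gaussianReal, neg_div] using h

theorem gaussianReal_Ioi (t : ℝ) :
    (ProbabilityTheory.gaussianReal 0 1).real (Set.Ioi t) = gaussianQ t := by
  rw [measureReal_def, ProbabilityTheory.gaussianReal_apply_eq_integral _ one_ne_zero,
    ENNReal.toReal_ofReal (integral_nonneg fun x => ProbabilityTheory.gaussianPDFReal_nonneg _ _ _)]
  simp [ProbabilityTheory.gaussianPDFReal, gaussianQ, integral_const_mul]

theorem gaussianReal_Iic (t : ℝ) :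
    (ProbabilityTheory.gaussianReal 0 1).real (Set.Iic t) = 1 - gaussianQ t := by
  rw [← gaussianReal_Ioi, ← Set.compl_Iic, probReal_compl_eq_one_sub measurableSet_Iic]
  ring

theorem antitone_gaussianQ : Antitone gaussianQ := fun a b hab => by
  rw [← gaussianReal_Ioi, ← gaussianReal_Ioi]
  exact measureReal_mono (Set.Ioi_subset_Ioi hab)

theorem gaussianQ_gaussianQInv {y : ℝ} (h0 : 0 < y) (h1 : y < 1) :
    gaussianQ (gaussianQInv y) = y := by
  obtain ⟨t, -, ht⟩ := gaussianQ_bijOn.surjOn ⟨h0, h1⟩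
  exact Function.invFun_eq ⟨t, ht⟩

theorem tendsto_scaledBinomial_Iic (t : ℝ) :
    Tendsto (fun n => (scaledBinomial n).real (Set.Iic t)) atTop (𝓝 (1 - gaussianQ t)) := by
  have h := ProbabilityMeasure.tendsto_measure_of_null_frontier_of_tendsto' tendsto_scaledBinomial
    (E := Set.Iic t) (by
      have := ProbabilityTheory.nullSingletonClass_gaussianReal (μ := 0) (v := 1) one_ne_zero
      simp)
  rw [← gaussianReal_Iic]
  exact (ENNReal.tendsto_toReal (measure_ne_top _ _)).comp h

/-- For `R < R'`, the polynomials of degree at most `r_m` in `m - 1` variables eventually make up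
a fraction less than `R'` of the dimension of the space of all functions on `𝔽₂ᵐ⁻¹`. Lowering the
number of variables from `m` to `m - 1` changes the normalised threshold by only `O(1 / √m)`. -/
theorem eventually_sum_choose_canonicalOrder_lt {R R' : ℝ} (hR0 : 0 < R) (hR : R < R')
    (hR1 : R < 1) : ∀ᶠ n : ℕ in atTop,
      ((∑ i ∈ Finset.range (canonicalOrder R (n + 1) + 1), n.choose i : ℕ) : ℝ) < R' * 2 ^ n := by
  obtain ⟨R₁, hR₁, hR₁'⟩ := exists_between (lt_min hR hR1)
  obtain ⟨h₁, h₂⟩ := lt_min_iff.1 hR₁'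
  set t := gaussianQInv (1 - R) with ht
  set t₁ := gaussianQInv (1 - R₁) with ht₁
  have hQ : gaussianQ t = 1 - R := gaussianQ_gaussianQInv (by linarith) (by linarith)
  have hQ₁ : gaussianQ t₁ = 1 - R₁ := gaussianQ_gaussianQInv (by linarith) (by linarith)
  have htt : t < t₁ := by
    by_contra h
    have := antitone_gaussianQ (not_lt.1 h)
    linarith
  have hlim := tendsto_scaledBinomial_Iic t₁
  rw [hQ₁, sub_sub_cancel] at hlim
  have hs : Tendsto (fun n : ℕ => √(n : ℝ)) atTop atTop :=
    Real.tendsto_sqrt_atTop.comp tendsto_natCast_atTop_atTop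
  have hsmall : ∀ᶠ n : ℕ in atTop, 1 + |t| < (t₁ - t) * √(n : ℝ) :=
    (hs.const_mul_atTop (sub_pos.2 htt)).eventually_gt_atTop _
  have hpos : ∀ᶠ n : ℕ in atTop, 1 + |t| < √(n : ℝ) := hs.eventually_gt_atTop _
  filter_upwards [hlim.eventually_lt_const h₁, hsmall, hpos] with n hn hn₁ hn₂
  have hn0 : 0 < √(n : ℝ) := lt_of_le_of_lt (by positivity) hn₂
  have hsq : √(n : ℝ) ^ 2 = n := Real.sq_sqrt n.cast_nonneg
  have hsq' : √((n + 1 : ℕ) : ℝ) ^ 2 = n + 1 := by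
    rw [Real.sq_sqrt (Nat.cast_nonneg _)]; push_cast; rfl
  have hle : √(n : ℝ) ≤ √((n + 1 : ℕ) : ℝ) := Real.sqrt_le_sqrt (by push_cast; linarith)
  have hle' : √((n + 1 : ℕ) : ℝ) ≤ √(n : ℝ) + 1 := by
    have := Real.sqrt_nonneg ((n + 1 : ℕ) : ℝ)
    nlinarith
  have habs := abs_le.1 (le_refl |t|)
  have ht' : √((n + 1 : ℕ) : ℝ) * t ≤ √(n : ℝ) * t + |t| := by
    have : (√((n + 1 : ℕ) : ℝ) - √(n : ℝ)) * t ≤ 1 * |t| :=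
      (mul_le_mul_of_nonneg_left (le_abs_self t) (by linarith)).trans
        (mul_le_mul_of_nonneg_right (by linarith) (abs_nonneg t))
    linarith
  -- The threshold is nonnegative, so the truncation at zero in `canonicalOrder` is inactive.
  have hcan : (canonicalOrder R (n + 1) : ℝ) ≤
      ((n + 1 : ℕ) : ℝ) / 2 + √((n + 1 : ℕ) : ℝ) / 2 * t := by
    have h0 : 0 ≤ ((n + 1 : ℕ) : ℝ) / 2 + √((n + 1 : ℕ) : ℝ) / 2 * t := by
      have : 0 ≤ √((n + 1 : ℕ) : ℝ) * (√((n + 1 : ℕ) : ℝ) + t) :=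
        mul_nonneg (Real.sqrt_nonneg _) (by linarith [habs.1])
      push_cast at *
      nlinarith
    have h1 := Int.floor_nonneg.2 h0
    have h2 : ((canonicalOrder R (n + 1) : ℕ) : ℤ) =
        ⌊((n + 1 : ℕ) : ℝ) / 2 + √((n + 1 : ℕ) : ℝ) / 2 * t⌋ := by
      rw [canonicalOrder, Int.toNat_of_nonneg (le_max_right _ _), max_eq_left h1]
    have h3 := Int.floor_le (((n + 1 : ℕ) : ℝ) / 2 + √((n + 1 : ℕ) : ℝ) / 2 * t)
    rw [← h2] at h3
    exact_mod_cast h3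
  have hval : (scaledBinomial n).real (Set.Iic t₁) = ∑ k ∈ Finset.range (n + 1),
      (n.choose k : ℝ) / 2 ^ n * (Set.Iic t₁).indicator 1 ((2 * k - n : ℝ) / √n) := by
    rw [measureReal_def, scaledBinomial_apply n measurableSet_Iic, ENNReal.toReal_ofReal]
    exact Finset.sum_nonneg fun k _ =>
      mul_nonneg (by positivity) (Set.indicator_nonneg (by simp) _)
  rw [← div_lt_iff₀ (by positivity), Nat.cast_sum, Finset.sum_div]
  refine lt_of_le_of_lt ?_ hn
  rw [hval]
  -- Indices beyond `n` contribute nothing, since `n.choose i = 0` there.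
  have hsub : ∑ i ∈ Finset.range (canonicalOrder R (n + 1) + 1), (n.choose i : ℝ) / 2 ^ n =
      ∑ i ∈ Finset.range (canonicalOrder R (n + 1) + 1) ∩ Finset.range (n + 1),
        (n.choose i : ℝ) / 2 ^ n := by
    refine (Finset.sum_subset Finset.inter_subset_left fun i hi hi' => ?_).symm
    rw [Finset.mem_inter, not_and] at hi'
    have := hi' hi
    rw [Nat.choose_eq_zero_of_lt (not_le.1 fun h => this (Finset.mem_range.2 (Nat.lt_succ_of_le h)))]
    simp
  rw [hsub]
  refine (Finset.sum_le_sum fun i hi => ?_).trans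
    (Finset.sum_le_sum_of_subset_of_nonneg Finset.inter_subset_right fun k _ _ =>
      mul_nonneg (by positivity) (Set.indicator_nonneg (by simp) _))
  have hi' : i ≤ canonicalOrder R (n + 1) :=
    Nat.lt_succ_iff.1 (Finset.mem_range.1 (Finset.mem_inter.1 hi).1)
  have hi'' : (i : ℝ) ≤ canonicalOrder R (n + 1) := by exact_mod_cast hi'
  have hmem : (2 * i - n : ℝ) / √n ∈ Set.Iic t₁ := by
    rw [Set.mem_Iic, div_le_iff₀ hn0]
    push_cast at *
    linarith
  rw [Set.indicator_of_mem hmem]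
  simp

/-! ### Determining Reed–Muller words from few pairs of coordinates -/

/-- A polynomial of degree at most `r` over `𝔽₂` that vanishes at all points having at most `r`
ones among the coordinates in `S` vanishes everywhere. The sum of `f` over the subcube of
the points below `x` in the coordinates of `S`, and equal to `x` in the others, is zero
by the Chevalley–Warning theorem, which gives `f x = 0` by induction on the number of ones. -/
theorem eval_eq_zero_of_eval_eq_zero_of_card_le {σ : Type*} [Fintype σ] [DecidableEq σ]
    (S : Finset σ) (f : MvPolynomial σ (ZMod 2)) {r : ℕ} (hf : f.totalDegree ≤ r)
    (h : ∀ x : σ → ZMod 2, {j ∈ S | x j = 1}.card ≤ r → MvPolynomial.eval x f = 0)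
    (x : σ → ZMod 2) : MvPolynomial.eval x f = 0 := by
  induction hw : {j ∈ S | x j = 1}.card using Nat.strong_induction_on generalizing x with
  | _ w ih =>
  by_cases hwr : w ≤ r
  · exact h x (hw ▸ hwr)
  set T : Finset σ := {j ∈ S | x j = 1} with hT
  -- The product is the indicator function of the points that agree with `x` outside `T`.
  set g : MvPolynomial σ (ZMod 2) :=
    f * ∏ j ∈ Tᶜ, (MvPolynomial.X j + MvPolynomial.C (x j + 1)) with hg
  have hdeg : g.totalDegree < (Fintype.card (ZMod 2) - 1) * Fintype.card σ := by
    have h1 : (∏ j ∈ Tᶜ, (MvPolynomial.X j + MvPolynomial.C (x j + 1)) :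
        MvPolynomial σ (ZMod 2)).totalDegree ≤ ∑ j ∈ Tᶜ, 1 :=
      (MvPolynomial.totalDegree_finsetProd _ _).trans (Finset.sum_le_sum fun j _ =>
        (MvPolynomial.totalDegree_add _ _).trans (by
          simp only [MvPolynomial.totalDegree_X, MvPolynomial.totalDegree_C]
          simp))
    have h2 := MvPolynomial.totalDegree_mul f
      (∏ j ∈ Tᶜ, (MvPolynomial.X j + MvPolynomial.C (x j + 1)))
    have h3 := Finset.card_add_card_compl T
    rw [Finset.sum_const, smul_eq_mul, mul_one] at h1
    rw [ZMod.card, hg]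
    omega
  have hsum := MvPolynomial.sum_eval_eq_zero g hdeg
  have hx : MvPolynomial.eval x g = MvPolynomial.eval x f := by
    rw [hg, map_mul, map_prod, Finset.prod_eq_one, mul_one]
    intro j _
    simp only [map_add, MvPolynomial.eval_X, MvPolynomial.eval_C]
    generalize x j = a
    revert a
    decide
  rw [Finset.sum_eq_single x, hx] at hsum
  · exact hsum
  · intro y _ hyx
    rw [hg, map_mul, map_prod]
    by_cases hy : ∀ j ∈ Tᶜ, y j = x j
    · rw [ih {j ∈ S | y j = 1}.card ?_ y rfl, zero_mul]
      rw [← hw]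
      obtain ⟨j, hj⟩ := Function.ne_iff.1 hyx
      have hjT : j ∈ T := by
        by_contra hjT
        exact hj (hy j (Finset.mem_compl.2 hjT))
      refine Finset.card_lt_card (Finset.ssubset_iff_of_subset ?_ |>.2 ⟨j, hjT, ?_⟩)
      · intro i hi
        by_contra hiT
        have hi' := Finset.mem_filter.1 hi
        have := hy i (Finset.mem_compl.2 hiT)
        exact hiT (Finset.mem_filter.2 ⟨hi'.1, this ▸ hi'.2⟩)
      · intro hjy
        exact hj ((Finset.mem_filter.1 hjy).2.trans (Finset.mem_filter.1 hjT).2.symm)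
    · push Not at hy
      obtain ⟨j, hj, hne⟩ := hy
      rw [Finset.prod_eq_zero hj, mul_zero]
      simp only [map_add, MvPolynomial.eval_X, MvPolynomial.eval_C]
      revert hne
      generalize x j = a
      generalize y j = b
      revert a b
      decide
  · simp

theorem lexPoint_bijective (m : ℕ) : Function.Bijective (lexPoint m) := by
  refine (Fintype.bijective_iff_injective_and_card _).2 ⟨fun i j hij => ?_, by simp⟩
  have key : ∀ {i j : Fin (2 ^ m)}, i < j → lexPoint m i ≠ lexPoint m j := by
    intro i j h e
    obtain ⟨k, -, h0, h1⟩ := lexPoint_lex m h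
    rw [e, h1] at h0
    exact one_ne_zero h0
  rcases lt_trichotomy i j with h | h | h
  · exact absurd hij (key h)
  · exact h
  · exact absurd hij.symm (key h)

/-- The position `2 q + b`, for a bit `b`, among the `2ⁿ⁺¹` positions. -/
def pairIndex {n : ℕ} (q : Fin (2 ^ n)) (b : ZMod 2) : Fin (2 ^ (n + 1)) :=
  ⟨2 * q + b.val, by have := q.2; have := b.val_lt; rw [pow_succ]; omega⟩

/-- The last bit of a point is the least significant bit of its position. -/
theorem lexPoint_pairIndex {n : ℕ} (q : Fin (2 ^ n)) (b : ZMod 2) :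
    lexPoint (n + 1) (pairIndex q b) = Fin.snoc (α := fun _ => ZMod 2) (lexPoint n q) b := by
  ext j
  refine Fin.lastCases ?_ (fun j => ?_) j
  · rw [Fin.snoc_last]
    revert b
    simp [lexPoint, pairIndex, Nat.testBit_zero]
    decide
  · rw [Fin.snoc_castSucc]
    have hb : b.val < 2 := b.val_lt
    have e : n + 1 - 1 - (j.castSucc : ℕ) = (n - 1 - (j : ℕ)) + 1 := by
      have := j.2
      simp only [Fin.val_castSucc]
      omega
    have e' : (2 * (q : ℕ) + b.val) / 2 = q := by omega
    simp only [lexPoint, e, pairIndex, Nat.testBit_succ, e']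

/-- A word of `RM(n + 1, r)` is determined by the pairs of consecutive coordinates at the
positions `2 q`, `2 q + 1` for which the point number `q` of `𝔽₂ⁿ` has at most `r` ones. -/
theorem reedMuller_ext {n r : ℕ} {c c' : Fin (2 ^ (n + 1)) → ZMod 2}
    (hc : c ∈ reedMuller (n + 1) r) (hc' : c' ∈ reedMuller (n + 1) r)
    (h : ∀ q : Fin (2 ^ n), (Finset.univ.filter fun j => lexPoint n q j = 1).card ≤ r →
      ∀ b, c (pairIndex q b) = c' (pairIndex q b)) : c = c' := by
  obtain ⟨f, hf, rfl⟩ := hc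
  obtain ⟨f', hf', rfl⟩ := hc'
  have hdeg : (f - f').totalDegree ≤ r :=
    (MvPolynomial.totalDegree_sub _ _).trans (max_le hf hf')
  have := eval_eq_zero_of_eval_eq_zero_of_card_le (Finset.univ.map Fin.castSuccEmb) (f - f') hdeg
    fun x hx => by
      obtain ⟨q, hq⟩ := (lexPoint_bijective n).2 fun j => x j.castSucc
      have hxq : x = lexPoint (n + 1) (pairIndex q (x (Fin.last n))) := by
        rw [lexPoint_pairIndex, hq]
        exact (Fin.snoc_init_self x).symm
      have hcard : (Finset.univ.filter fun j => lexPoint n q j = 1).card ≤ r := by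
        rw [Finset.filter_map, Finset.card_map] at hx
        rw [hq]
        exact hx
      have := h q hcard (x (Fin.last n))
      simp only at this
      rw [← hxq] at this
      rw [map_sub, this, sub_self]
  funext i
  have := this (lexPoint (n + 1) i)
  rwa [map_sub, sub_eq_zero] at this

theorem card_filter_card_le (n r : ℕ) :
    (Finset.univ.filter fun s : Finset (Fin n) => s.card ≤ r).card =
      ∑ i ∈ Finset.range (r + 1), n.choose i := by
  rw [Finset.card_eq_sum_card_fiberwise (f := Finset.card) (t := Finset.range (r + 1))]
  · refine Finset.sum_congr rfl fun i hi => ?_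
    rw [← Finset.card_fin n, ← Finset.card_powersetCard, Finset.card_fin]
    congr 1
    ext s
    have := Finset.mem_range.1 hi
    simp [Finset.mem_powersetCard]
    omega
  · intro s hs
    simpa [Nat.lt_succ_iff] using hs

/-- The number of points of `𝔽₂ⁿ` with at most `r` ones. -/
theorem card_lexPoint_le (n r : ℕ) :
    (Finset.univ.filter fun q : Fin (2 ^ n) =>
      (Finset.univ.filter fun j => lexPoint n q j = 1).card ≤ r).card =
      ∑ i ∈ Finset.range (r + 1), n.choose i := by
  rw [← card_filter_card_le]
  refine Finset.card_bij (fun q _ => Finset.univ.filter fun j => lexPoint n q j = 1)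
    (by simp) (fun q _ q' _ h => ?_) (fun s hs => ?_)
  · refine (lexPoint_bijective n).1 (funext fun j => ?_)
    have h2 := Finset.ext_iff.1 h j
    simp only [Finset.mem_filter, Finset.mem_univ, true_and] at h2
    revert h2
    generalize lexPoint n q j = a
    generalize lexPoint n q' j = b
    revert a b
    decide
  · obtain ⟨q, hq⟩ := (lexPoint_bijective n).2 fun j => if j ∈ s then 1 else 0
    have : (Finset.univ.filter fun j => lexPoint n q j = 1) = s := by
      ext j
      simp [hq]
    refine ⟨q, ?_, this⟩
    simpa [this] using hs

/-- Each of the pairs of coordinates that determine a word takes at most three values when the word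
has no two consecutive ones. -/
theorem card_le_of_isRLL_of_subset_reedMuller {n r : ℕ} {D : Finset (Fin (2 ^ (n + 1)) → ZMod 2)}
    (hD : (D : Set (Fin (2 ^ (n + 1)) → ZMod 2)) ⊆ reedMuller (n + 1) r)
    (hRLL : ∀ c ∈ D, IsRLL 1 c) : D.card ≤ 3 ^ ∑ i ∈ Finset.range (r + 1), n.choose i := by
  rw [← card_lexPoint_le]
  set Q := Finset.univ.filter fun q : Fin (2 ^ n) =>
      (Finset.univ.filter fun j => lexPoint n q j = 1).card ≤ r with hQ
  have hpair : ∀ c ∈ D, ∀ q : Fin (2 ^ n), (c (pairIndex q 0), c (pairIndex q 1)) ≠ (1, 1) := by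
    intro c hc q h
    have := hRLL c hc (pairIndex q 0) (pairIndex q 1) (by simp [pairIndex, Fin.lt_def])
      (Prod.ext_iff.1 h).1 (Prod.ext_iff.1 h).2
    simp [pairIndex, ZMod.val_one] at this
  let F : D → (Q → {p : ZMod 2 × ZMod 2 // p ≠ (1, 1)}) := fun c q => ⟨_, hpair c c.2 q⟩
  have hF : Function.Injective F := by
    intro c c' h
    refine Subtype.ext (reedMuller_ext (hD c.2) (hD c'.2) fun q hq b => ?_)
    have h1 := Subtype.ext_iff.1 (congrFun h ⟨q, Finset.mem_filter.2 ⟨Finset.mem_univ _, hq⟩⟩)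
    have h2 := Prod.ext_iff.1 h1
    fin_cases b
    · exact h2.1
    · exact h2.2
  have h3 : Fintype.card {p : ZMod 2 × ZMod 2 // p ≠ (1, 1)} = 3 := by decide
  have := Fintype.card_le_of_injective F hF
  rwa [Fintype.card_fun, h3, Fintype.card_coe, Fintype.card_coe] at this

/-! ### The noiseless capacity -/

theorem isRLL_one_iff {n : ℕ} (c : Fin n → ZMod 2) :
    IsRLL 1 c ↔ ∀ (i : ℕ) (h : i + 1 < n), ¬(c ⟨i, by omega⟩ = 1 ∧ c ⟨i + 1, h⟩ = 1) := by
  refine ⟨fun hc i h hi => ?_, fun hc i j hij hi hj => ?_⟩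
  · have := hc ⟨i, by omega⟩ ⟨i + 1, h⟩ (by simp [Fin.lt_def]) hi.1 hi.2
    simp at this
  · by_contra hlt
    have hij' : (i : ℕ) < j := hij
    have e : (j : ℕ) = i + 1 := by omega
    refine hc i (e ▸ j.2) ⟨hi, ?_⟩
    rw [← hj]
    congr 1
    exact Fin.ext e.symm

theorem isRLL_one_cons_zero {n : ℕ} (c : Fin n → ZMod 2) :
    IsRLL 1 (Fin.cons (α := fun _ => ZMod 2) 0 c : Fin (n + 1) → ZMod 2) ↔ IsRLL 1 c := by
  rw [isRLL_one_iff, isRLL_one_iff]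
  refine ⟨fun h i hi => h (i + 1) (by omega), fun h i hi => ?_⟩
  cases i with
  | zero => exact fun hh => zero_ne_one hh.1
  | succ i => exact h i (by omega)

theorem isRLL_one_cons_one {n : ℕ} (c : Fin (n + 1) → ZMod 2) :
    IsRLL 1 (Fin.cons (α := fun _ => ZMod 2) 1 c : Fin (n + 2) → ZMod 2) ↔
      c 0 = 0 ∧ IsRLL 1 c := by
  have hne : ∀ a : ZMod 2, a ≠ 1 ↔ a = 0 := by decide
  rw [isRLL_one_iff, isRLL_one_iff]
  refine ⟨fun h => ⟨(hne _).1 fun hc => h 0 (by omega) ⟨rfl, hc⟩,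
    fun i hi => h (i + 1) (by omega)⟩, fun h i hi => ?_⟩
  cases i with
  | zero => exact fun hh => zero_ne_one (h.1.symm.trans hh.2)
  | succ i => exact h.2 i (by omega)

/-- Words without consecutive ones are counted by the Fibonacci numbers: such a word of length
`n + 2` begins with `0` or with `10`, and the rest is arbitrary. -/
theorem ncard_isRLL_one (n : ℕ) : {c : Fin n → ZMod 2 | IsRLL 1 c}.ncard = Nat.fib (n + 2) := by
  induction n using Nat.twoStepInduction with
  | zero =>
    have : {c : Fin 0 → ZMod 2 | IsRLL 1 c} = Set.univ :=
      Set.eq_univ_of_forall fun c i => i.elim0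
    rw [this, Set.ncard_univ]
    simp
  | one =>
    have : {c : Fin 1 → ZMod 2 | IsRLL 1 c} = Set.univ :=
      Set.eq_univ_of_forall fun c i j hij => by omega
    rw [this, Set.ncard_univ]
    simp [Nat.fib]
  | more n ih₀ ih₁ =>
    have hsplit : {c : Fin (n + 2) → ZMod 2 | IsRLL 1 c} =
        (fun c => (Fin.cons (α := fun _ => ZMod 2) 1 (Fin.cons (α := fun _ => ZMod 2) 0 c) :
            Fin (n + 2) → ZMod 2)) '' {c : Fin n → ZMod 2 | IsRLL 1 c} ∪
        (fun c => (Fin.cons (α := fun _ => ZMod 2) 0 c : Fin (n + 2) → ZMod 2)) ''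
            {c : Fin (n + 1) → ZMod 2 | IsRLL 1 c} := by
      ext c
      simp only [Set.mem_union, Set.mem_image, Set.mem_ofPred_eq]
      constructor
      · intro hc
        have h01 : ∀ a : ZMod 2, a = 1 ∨ a = 0 := by decide
        rw [← Fin.cons_self_tail c] at hc ⊢
        rcases h01 (c 0) with h | h <;> rw [h] at hc ⊢
        · rw [isRLL_one_cons_one, ← Fin.cons_self_tail (Fin.tail c)] at hc
          obtain ⟨h0, hc⟩ := hc
          rw [Fin.cons_zero] at h0
          rw [h0, isRLL_one_cons_zero] at hc
          exact Or.inl ⟨_, hc, by rw [← h0, Fin.cons_self_tail]⟩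
        · exact Or.inr ⟨_, (isRLL_one_cons_zero _).1 hc, rfl⟩
      · rintro (⟨c, hc, rfl⟩ | ⟨c, hc, rfl⟩)
        · exact (isRLL_one_cons_one _).2 ⟨rfl, (isRLL_one_cons_zero _).2 hc⟩
        · exact (isRLL_one_cons_zero _).2 hc
    rw [hsplit, Set.ncard_union_eq _ (Set.toFinite _) (Set.toFinite _), Set.ncard_image_of_injective,
      Set.ncard_image_of_injective, ih₀, ih₁, ← Nat.fib_add_two]
    · exact Fin.cons_right_injective (α := fun _ => ZMod 2) 0
    · exact (Fin.cons_right_injective (α := fun _ => ZMod 2) 1).comp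
        (Fin.cons_right_injective (α := fun _ => ZMod 2) 0)
    · rw [Set.disjoint_left]
      rintro _ ⟨c, -, rfl⟩ ⟨c', -, h⟩
      have := congrFun h 0
      simp at this

theorem goldenRatio_pow_le_fib (n : ℕ) : Real.goldenRatio ^ n ≤ Nat.fib (n + 2) := by
  induction n using Nat.twoStepInduction with
  | zero => simp
  | one => simpa [Nat.fib] using Real.goldenRatio_lt_two.le
  | more n ih₀ ih₁ =>
    have h := Real.goldenRatio_pow_sub_goldenRatio_pow n
    rw [Nat.fib_add_two]
    push_cast
    linarith

theorem fib_le_goldenRatio_pow (n : ℕ) : (Nat.fib (n + 2) : ℝ) ≤ Real.goldenRatio ^ (n + 1) := by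
  induction n using Nat.twoStepInduction with
  | zero => simpa using Real.one_lt_goldenRatio.le
  | one =>
    rw [Real.goldenRatio_sq]
    have := Real.one_lt_goldenRatio
    norm_num [Nat.fib]
    linarith
  | more n ih₀ ih₁ =>
    have h := Real.goldenRatio_pow_sub_goldenRatio_pow (n + 1)
    rw [Nat.fib_add_two]
    push_cast
    linarith

theorem isNoiselessCapacity_one :
    IsNoiselessCapacity 1 (Real.logb 2 ((1 + Real.sqrt 5) / 2)) := by
  change Tendsto _ _ (𝓝 (Real.logb 2 Real.goldenRatio))
  set φ := Real.goldenRatio with hφ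
  have hlim : Tendsto (fun n : ℕ => Real.logb 2 φ + Real.logb 2 φ / n) atTop
      (𝓝 (Real.logb 2 φ)) := by
    simpa using tendsto_const_nhds.add
      (tendsto_const_div_atTop_nhds_zero_nat (Real.logb 2 φ))
  refine tendsto_of_tendsto_of_tendsto_of_le_of_le' tendsto_const_nhds hlim ?_ ?_ <;>
    filter_upwards [eventually_gt_atTop 0] with n hn <;>
    have hn' : (0 : ℝ) < n := by exact_mod_cast hn
  · rw [ncard_isRLL_one, le_div_iff₀ hn', mul_comm, ← Real.logb_pow]
    exact Real.logb_le_logb_of_le one_lt_two (pow_pos Real.goldenRatio_pos _)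
      (goldenRatio_pow_le_fib n)
  · rw [ncard_isRLL_one, div_le_iff₀ hn', add_mul, div_mul_cancel₀ _ hn'.ne']
    calc Real.logb 2 (Nat.fib (n + 2)) ≤ Real.logb 2 (φ ^ (n + 1)) :=
          Real.logb_le_logb_of_le one_lt_two
            (by exact_mod_cast Nat.fib_pos.2 (by omega)) (fib_le_goldenRatio_pow n)
      _ = Real.logb 2 φ * n + Real.logb 2 φ := by
          rw [Real.logb_pow]; push_cast; ring

/-! ### The bound on the rate -/

theorem codeRate_le_of_card_le {n : ℕ} {C : Finset (Fin n → ZMod 2)} (hC : C.Nonempty) {N : ℕ}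
    (h : C.card ≤ N) : codeRate C ≤ Real.logb 2 N / n :=
  div_le_div_of_nonneg_right (Real.logb_le_logb_of_le one_lt_two
    (by exact_mod_cast hC.card_pos) (by exact_mod_cast h)) n.cast_nonneg

theorem logb_two_three_le : Real.logb 2 3 ≤ 8 / 5 := by
  have h : Real.logb 2 ((3 : ℝ) ^ 5) ≤ Real.logb 2 ((2 : ℝ) ^ 8) :=
    Real.logb_le_logb_of_le one_lt_two (by norm_num) (by norm_num)
  rw [Real.logb_pow, Real.logb_pow, Real.logb_self_eq_one one_lt_two] at h
  norm_num at h
  linarith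

theorem mainTheorem3 (R : ℝ) (hR0 : 0 < R) (hR1 : R < 1) :
    IsNoiselessCapacity 1 (Real.logb 2 ((1 + Real.sqrt 5) / 2)) ∧
    limsup (fun m : ℕ => largestRLLRate 1 (reedMuller m (canonicalOrder R m))) atTop ≤
      ((min (7 * R / 8) (Real.logb 2 ((1 + Real.sqrt 5) / 2)) : ℝ) : EReal) := by
  refine ⟨isNoiselessCapacity_one, ?_⟩
  rw [EReal.coe_strictMono.monotone.map_min]
  refine le_min ?_ ?_
  · refine limsup_le_of_le ?_ ?_
    · isBoundedDefault
    rw [← map_add_atTop_eq_nat 1, eventually_map]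
    -- There is room for `35 / 32 * R` instead of `R`, since `8 / 5 / 2 * (35 / 32) = 7 / 8`.
    filter_upwards [eventually_sum_choose_canonicalOrder_lt (R' := 35 / 32 * R) hR0 (by linarith)
      hR1] with n hn
    refine iSup₂_le fun D hD => EReal.coe_le_coe_iff.2 ?_
    refine (codeRate_le_of_card_le hD.1
      (card_le_of_isRLL_of_subset_reedMuller hD.2.1 hD.2.2)).trans ?_
    have h2 : (0 : ℝ) < 2 ^ n := by positivity
    push_cast at hn ⊢
    rw [Real.logb_pow, div_le_iff₀ (by positivity), pow_succ]
    push_cast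
    have := mul_le_mul hn.le logb_two_three_le (Real.logb_nonneg one_lt_two (by norm_num))
      (by positivity)
    linarith
  · have hlim := (isNoiselessCapacity_one.comp
      (tendsto_pow_atTop_atTop_of_one_lt (one_lt_two (α := ℕ))))
    have hlim' := (continuous_coe_real_ereal.tendsto _).comp hlim
    rw [← hlim'.limsup_eq]
    refine limsup_le_limsup (Eventually.of_forall fun m => ?_)
    refine iSup₂_le fun D hD => EReal.coe_le_coe_iff.2 ?_
    refine codeRate_le_of_card_le hD.1 ?_
    rw [← Set.ncard_coe_finset]
    exact Set.ncard_le_ncard hD.2.2 (Set.toFinite _)
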